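/- Consider two transmitters and two receivers with four antennas each; transmitter $i$ has eight complex symbols $x_{ij}=(x_{ij}^1,\dots,x_{ij}^8)$ for receiver $j$ ($i,j\in\{1,2\}$), where $x_{ij}^k$ is drawn from a finite constellation $S_{ij}^k\subset\mathbb C$. Assume every $S_{ij}^k$ has nonzero coordinate product distance, i.e. $\min_{u\ne v\in S_{ij}^k}|u^R-v^R||u^I-v^I|\neq 0$ (superscripts $R$, $I$ denote real and imaginary parts). Write $\mathsf{j}=\sqrt{-1}$. For $\theta\in\mathbb R$ and $x=(x^1,\dots,x^8)$ let $$C_\theta(x)=\begin{bmatrix} x^{1R}+\mathsf{j}x^{3I} & -x^{2R}+\mathsf{j}x^{4I} & e^{\mathsf{j}\theta}(x^{5R}+\mathsf{j}x^{7I}) & e^{\mathsf{j}\theta}(-x^{6R}+\mathsf{j}x^{8I})\\ x^{2R}+\mathsf{j}x^{4I} & x^{1R}-\mathsf{j}x^{3I} & e^{\mathsf{j}\theta}(x^{6R}+\mathsf{j}x^{8I}) & e^{\mathsf{j}\theta}(x^{5R}-\mathsf{j}x^{7I})\\ e^{\mathsf{j}\theta}(x^{7R}+\mathsf{j}x^{5I})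 & e^{\mathsf{j}\theta}(-x^{8R}+\mathsf{j}x^{6I}) & x^{3R}+\mathsf{j}x^{1I} & -x^{4R}+\mathsf{j}x^{2I}\\ e^{\mathsf{j}\theta}(x^{8R}+\mathsf{j}x^{6I}) & e^{\mathsf{j}\theta}(x^{7R}-\mathsf{j}x^{5I}) & x^{4R}+\mathsf{j}x^{2I} & x^{3R}-\mathsf{j}x^{1I}\end{bmatrix}$$ with columns $c_1,\dots,c_4$, and assume $\theta$ is such that for all $i,j$ and all distinct symbol vectors $s\neq t$ with $s^k,t^k\in S_{ij}^k$ the difference matrix $C_\theta(s)-C_\theta(t)$ has full rank. Let $X'_{ij}=C_\theta(x_{ij})$, and let $X_{i1}=[c_1,c_2,0,c_3,c_4,0]$ and $X_{i2}=[0,c_1,c_2,0,c_3,c_4]$ be the $4\times6$ matrices formed from the columns of $X'_{i1}$ and $X'_{i2}$ respectively. Let $H_{ij}\in\mathbb C^{4\times4}$ be the channel from transmitter $i$ to receiver $j$, and let $V_{ij}=H_{ij'}^{-1}/\sqrt{\mathrm{tr}(H_{ij'}^{-1}H_{ij'}^{-H})}$, where $j'\neq j$ is the other receiver. At power $P>0$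 transmitter $i$ sends $\sqrt{3P/4}\,(V_{i1}X_{i1}+V_{i2}X_{i2})$ and receiver $j$ observes $Y_j=\sqrt{3P/4}\sum_{i=1}^2H_{ij}(V_{i1}X_{i1}+V_{i2}X_{i2})+N_j\in\mathbb C^{4\times6}$. For each $j$, all entries of the four channel matrices and of $N_j$ are i.i.d. $\mathcal{CN}(0,1)$, and the channels are known at the receiver. With $w=e^{2\mathsf{j}\theta}$, receiver 1 forms $Y_1'\in\mathbb C^{4\times4}$, where, writing $y_{ab}$ for the entries of $Y_1$, $$Y'_1=\begin{bmatrix} y_{11}&y_{12}-\overline{y_{23}}&y_{14}&y_{15}-w\overline{y_{26}}\\ y_{21}&y_{22}+\overline{y_{13}}&y_{24}&y_{25}+w\overline{y_{16}}\\ y_{31}&y_{32}-w\overline{y_{43}}&y_{34}&y_{35}-\overline{y_{46}}\\ y_{41}&y_{42}+w\overline{y_{33}}&y_{44}&y_{45}+\overline{y_{36}}\end{bmatrix},$$ and similarly receiver 2 forms, writing $y_{ab}$ for the entries of $Y_2$, $$Y'_2=\begin{bmatrix} y_{12}+\overline{y_{21}}&y_{13}&y_{15}+w\overline{y_{24}}&y_{16}\\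 y_{22}-\overline{y_{11}}&y_{23}&y_{25}-w\overline{y_{14}}&y_{26}\\ y_{32}+w\overline{y_{41}}&y_{33}&y_{35}+\overline{y_{44}}&y_{36}\\ y_{42}-w\overline{y_{31}}&y_{43}&y_{45}-\overline{y_{34}}&y_{46}\end{bmatrix}.$$ Almost surely $Y'_j=\sqrt{3P/4}\,(H_{1j}V_{1j}X'_{1j}+H_{2j}V_{2j}X'_{2j})+N'_j$, where the entries of $N'_j$ are independent complex Gaussians, of variances $1,2,1,2$ in columns $1,\dots,4$ for $j=1$ and $2,1,2,1$ for $j=2$. Maximum likelihood (ML) decoding of $(X'_{1j},X'_{2j})$ from $Y'_j$ is with respect to this model. Then there is a constant $c>0$, depending only on the constellations and $\theta$, such that for $j=1,2$: (a) for all $P>0$, all transmitted symbols and every pair of symbol vectors for receiver $j$ different from the transmitted pair $(x_{1j},x_{2j})$, the average (over channels and noise) pairwise error probability, i.e. the probability that, given $Y'_j$ and the channels, the competing pair is at least as likely as the transmitted one, is at most $cP^{-4}$; (b) ML decoding of $(X'_{1j},X'_{2j})$ from $Y'_j$, with ties broken arbitrarily, has diversity gain at least four: if all symbols are independent and uniform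 on their constellations, independent of channels and noise, then the average error probability $P_e(P)$ satisfies $\liminf_{P\to\infty}\frac{-\log P_e(P)}{\log P}\ge4$. -/

import Mathlib

open MeasureTheory ProbabilityTheory Filter
open scoped NNReal ENNReal Matrix

noncomputable section

namespace XNetwork

/-- Circularly symmetric complex Gaussian law `CN(0, v)`: independent real and imaginary parts,
each `N(0, v / 2)`. -/
def complexGaussian (v : ℝ≥0) : Measure ℂ :=
  ((gaussianReal 0 (v / 2)).prod (gaussianReal 0 (v / 2))).map
    (fun p : ℝ × ℝ => (⟨p.1, p.2⟩ : ℂ))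

/-- Density of `CN(0, v)` with respect to Lebesgue measure on `ℂ`. -/
def complexGaussianPDF (v : ℝ) (z : ℂ) : ℝ :=
  (Real.pi * v)⁻¹ * Real.exp (-‖z‖ ^ 2 / v)

/-! ### Constellations -/

/-- Coordinate product distance between two points. -/
def pointCPD (u v : ℂ) : ℝ := |u.re - v.re| * |u.im - v.im|

/-- Coordinate product distance of a finite constellation: the minimum over all pairs of distinct
points (`∞` if there is no such pair). -/
def constellationCPD (S : Finset ℂ) : ℝ≥0∞ :=
  S.offDiag.inf fun p => ENNReal.ofReal (pointCPD p.1 p.2)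

/-- All symbol vectors `(x¹, …, x⁸)` with `xᵏ` in the `k`-th constellation. -/
def symbolVectors (S : Fin 8 → Finset ℂ) : Finset (Fin 8 → ℂ) := Fintype.piFinset S

/-! ### The space-time block code -/

/-- The mixed symbol `xᵖᴿ + j x^{qI}`. -/
def mix (x : Fin 8 → ℂ) (p q : Fin 8) : ℂ := (x p).re + Complex.I * (x q).im

/-- The Srinath-Rajan code matrix of eight symbols (symbol `k` has index `k - 1`).
Note that `-x²ᴿ + j x⁴ᴵ = -star (x²ᴿ + j x⁴ᴵ)`, and so on. -/
def srCode (θ : ℝ) (x : Fin 8 → ℂ) : Matrix (Fin 4) (Fin 4) ℂ :=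
  let e : ℂ := Complex.exp (Complex.I * θ)
  !![mix x 0 2, -star (mix x 1 3), e * mix x 4 6, e * -star (mix x 5 7);
     mix x 1 3, star (mix x 0 2), e * mix x 5 7, e * star (mix x 4 6);
     e * mix x 6 4, e * -star (mix x 7 5), mix x 2 0, -star (mix x 3 1);
     e * mix x 7 5, e * star (mix x 6 4), mix x 3 1, star (mix x 2 0)]

/-- The code matrix spread over six channel uses: zero columns three and six for the symbols meant
for receiver 1 (index `0`), zero columns one and four for those meant for receiver 2. -/
def spread (j : Fin 2) (M : Matrix (Fin 4) (Fin 4) ℂ) : Matrix (Fin 4) (Fin 6) ℂ :=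
  match j with
  | 0 => Matrix.of fun a => ![M a 0, M a 1, 0, M a 2, M a 3, 0]
  | 1 => Matrix.of fun a => ![0, M a 0, M a 1, 0, M a 2, M a 3]

/-! ### Transmission and reception -/

/-- Channel matrices: `H i j` is the channel from transmitter `i` to receiver `j`. -/
abbrev Channels := Fin 2 → Fin 2 → Matrix (Fin 4) (Fin 4) ℂ

/-- Precoder `V i j` of transmitter `i` for the symbols meant for receiver `j`: the inverse of the
channel to the other receiver, scaled to unit Frobenius norm. -/
def precoder (H : Channels) (i j : Fin 2) : Matrix (Fin 4) (Fin 4) ℂ :=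
  let A := (H i j.rev)⁻¹
  (((Real.sqrt (A * Aᴴ).trace.re)⁻¹ : ℝ) : ℂ) • A

/-- Matrix sent by transmitter `i` over six channel uses, at power `P`; `x i j` is the vector of
symbols of transmitter `i` for receiver `j`. -/
def transmitted (θ P : ℝ) (H : Channels) (x : Fin 2 → Fin 2 → Fin 8 → ℂ) (i : Fin 2) :
    Matrix (Fin 4) (Fin 6) ℂ :=
  (Real.sqrt (3 * P / 4) : ℂ) • ∑ j, precoder H i j * spread j (srCode θ (x i j))

/-- Output matrix at receiver `j`, with noise matrix `N`. -/
def received (θ P : ℝ) (H : Channels) (x : Fin 2 → Fin 2 → Fin 8 → ℂ) (j : Fin 2)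
    (N : Matrix (Fin 4) (Fin 6) ℂ) : Matrix (Fin 4) (Fin 6) ℂ :=
  ∑ i, H i j * transmitted θ P H x i + N

/-- Interference cancellation at receiver `j`. At receiver 1 the interference in columns two and
five is cancelled by means of columns three and six, which carry no desired symbols; at receiver 2
it is cancelled by means of columns one and four. -/
def process (θ : ℝ) (j : Fin 2) (Y : Matrix (Fin 4) (Fin 6) ℂ) : Matrix (Fin 4) (Fin 4) ℂ :=
  let w : ℂ := Complex.exp (Complex.I * (2 * θ))
  match j with
  | 0 =>
    !![Y 0 0, Y 0 1 - star (Y 1 2), Y 0 3, Y 0 4 - w * star (Y 1 5);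
       Y 1 0, Y 1 1 + star (Y 0 2), Y 1 3, Y 1 4 + w * star (Y 0 5);
       Y 2 0, Y 2 1 - w * star (Y 3 2), Y 2 3, Y 2 4 - star (Y 3 5);
       Y 3 0, Y 3 1 + w * star (Y 2 2), Y 3 3, Y 3 4 + star (Y 2 5)]
  | 1 =>
    !![Y 0 1 + star (Y 1 0), Y 0 2, Y 0 4 + w * star (Y 1 3), Y 0 5;
       Y 1 1 - star (Y 0 0), Y 1 2, Y 1 4 - w * star (Y 0 3), Y 1 5;
       Y 2 1 + w * star (Y 3 0), Y 2 2, Y 2 4 + star (Y 3 3), Y 2 5;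
       Y 3 1 - w * star (Y 2 0), Y 3 2, Y 3 4 - star (Y 2 3), Y 3 5]

/-- Noise variance in each column of the processed output at receiver `j`. -/
def noiseVar (j : Fin 2) : Fin 4 → ℝ :=
  match j with
  | 0 => ![1, 2, 1, 2]
  | 1 => ![2, 1, 2, 1]

/-- The noiseless processed output at receiver `j` when `d i` is the vector of symbols of
transmitter `i` for receiver `j`. -/
def signal (θ P : ℝ) (H : Channels) (j : Fin 2) (d : Fin 2 → Fin 8 → ℂ) :
    Matrix (Fin 4) (Fin 4) ℂ :=
  (Real.sqrt (3 * P / 4) : ℂ) • ∑ i, H i j * precoder H i j * srCode θ (d i)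

/-! ### Maximum likelihood decoding -/

/-- Likelihood of the desired symbols `d` given the processed output `Y` and the channels: the
entries of the processed noise are independent `CN(0, noiseVar j b)`, `b` the column. -/
def likelihood (θ P : ℝ) (H : Channels) (j : Fin 2) (Y : Matrix (Fin 4) (Fin 4) ℂ)
    (d : Fin 2 → Fin 8 → ℂ) : ℝ :=
  ∏ a, ∏ b, complexGaussianPDF (noiseVar j b) (Y a b - signal θ P H j d a b)

/-- All pairs of desired symbol vectors at receiver `j`. -/
def desired (S : Fin 2 → Fin 2 → Fin 8 → Finset ℂ) (j : Fin 2) : Finset (Fin 2 → Fin 8 → ℂ) :=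
  Fintype.piFinset fun i => symbolVectors (S i j)

/-- All families of symbols `x i j k`, for both transmitters and both receivers. -/
def allSymbols (S : Fin 2 → Fin 2 → Fin 8 → Finset ℂ) : Finset (Fin 2 → Fin 2 → Fin 8 → ℂ) :=
  Fintype.piFinset fun i => Fintype.piFinset fun j => symbolVectors (S i j)

/-- `dec` is a maximum likelihood decoder at receiver `j`, which knows all the channels
(ties are broken arbitrarily). -/
def IsMLDecoder (S : Fin 2 → Fin 2 → Fin 8 → Finset ℂ) (θ P : ℝ) (j : Fin 2)
    (dec : Channels → Matrix (Fin 4) (Fin 4) ℂ → Fin 2 → Fin 8 → ℂ) : Prop :=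
  ∀ H Y, dec H Y ∈ desired S j ∧
    ∀ d ∈ desired S j, likelihood θ P H j Y d ≤ likelihood θ P H j Y (dec H Y)

section Probability

variable {Ω : Type*} [MeasurableSpace Ω]

/-- All entries of all channel matrices `H i j` and of the noise matrix `N` are i.i.d. `CN(0, 1)`. -/
structure IsRayleigh (μ : Measure Ω) (H : Ω → Channels) (N : Ω → Matrix (Fin 4) (Fin 6) ℂ) :
    Prop where
  indep : iIndepFun
    (Sum.elim (fun (a : Fin 2 × Fin 2 × Fin 4 × Fin 4) ω => H ω a.1 a.2.1 a.2.2.1 a.2.2.2)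
      (fun (a : Fin 4 × Fin 6) ω => N ω a.1 a.2)) μ
  channel_law : ∀ i j a b, HasLaw (fun ω => H ω i j a b) (complexGaussian 1) μ
  noise_law : ∀ a b, HasLaw (fun ω => N ω a b) (complexGaussian 1) μ

/-- Average (over channels and noise) pairwise error probability at receiver `j`: the symbols `x`
are sent, and the competing desired symbols `d` are at least as likely as the true ones. -/
def pairwiseError (μ : Measure Ω) (H : Ω → Channels) (N : Ω → Matrix (Fin 4) (Fin 6) ℂ)
    (θ P : ℝ) (j : Fin 2) (x : Fin 2 → Fin 2 → Fin 8 → ℂ) (d : Fin 2 → Fin 8 → ℂ) : ℝ :=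
  μ.real {ω |
    likelihood θ P (H ω) j (process θ j (received θ P (H ω) x j (N ω))) (fun i => x i j) ≤
      likelihood θ P (H ω) j (process θ j (received θ P (H ω) x j (N ω))) d}

/-- Average error probability at receiver `j` of the decoder `dec` of the desired symbols, all
symbols being uniformly distributed on their constellations, independently of each other and of
the channels and the noise. -/
def errorProb (S : Fin 2 → Fin 2 → Fin 8 → Finset ℂ) (μ : Measure Ω) (H : Ω → Channels)
    (N : Ω → Matrix (Fin 4) (Fin 6) ℂ) (θ P : ℝ) (j : Fin 2)
    (dec : Channels → Matrix (Fin 4) (Fin 4) ℂ → Fin 2 → Fin 8 → ℂ) : ℝ≥0∞ :=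
  ((allSymbols S).card : ℝ≥0∞)⁻¹ * ∑ x ∈ allSymbols S,
    μ {ω | dec (H ω) (process θ j (received θ P (H ω) x j (N ω))) ≠ fun i => x i j}

end Probability

/-- Diversity gain of an error probability `pe` as a function of the power `P`: the lower limit of
`-log pe(P) / log P` as `P → ∞` (with `-log 0 = ∞`). -/
def diversityGain (pe : ℝ → ℝ≥0∞) : EReal :=
  liminf (fun P : ℝ => -ENNReal.log (pe P) / (Real.log P : EReal)) atTop

end XNetwork

end

open XNetwork

namespace XNetwork

/-! ### The complex Gaussian law -/

/-! Cancellation is exact. The precoder turns the channel of each interfering stream into a real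
multiple of the identity (`mul_precoder_rev`). The real-linear map `process` annihilates the spread
codeword thanks to its Alamouti blocks (`process_spread_rev`) and returns the desired stream
untouched (`process_mul_spread`). What remains is signal plus processed noise (`process_received`).

For a competing pair with noiseless output difference `D`, the error event is `W + 2 Re⟨A, N⟩ ≤ 0`,
where `W` is the weighted squared norm of `D` and `A` its image under the weighted adjoint of
`process`. Since `‖A‖² = W`, the Chernoff bound averaged over the noise gives `exp (-W / 4)`
(`lintegral_exp_chernoffExponent_le`).

It remains to average over the channels. Some transmitter `i₀` has an invertible code difference
`M`, and its precoder `V` has unit norm almost surely, so some entry `(p, k)` of `V * M` is bounded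
below by a constant (`exists_le_normSq_mul`). `V` depends only on channels to the other receiver.
Freezing all but column `p` of the direct channel of `i₀`, the four entries in column `k` of the
output difference are affine in four independent Gaussians with this common slope. Each contributes
`O(1 / P)`, uniformly in the offsets (`lintegral_exp_affine_le`), hence `P⁻⁴`. A union bound over
competitors gives the diversity gain. -/

instance isProbabilityMeasure_complexGaussian (v : ℝ≥0) :
    IsProbabilityMeasure (complexGaussian v) :=
  Measure.isProbabilityMeasure_map Complex.measurableEquivRealProd.symm.measurable.aemeasurable

lemma lintegral_complexGaussian (v : ℝ≥0) {f : ℂ → ℝ≥0∞} (hf : Measurable f) :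
    ∫⁻ z, f z ∂complexGaussian v =
      ∫⁻ x, ∫⁻ y, f ⟨x, y⟩ ∂gaussianReal 0 (v / 2) ∂gaussianReal 0 (v / 2) := by
  have hm : Measurable (fun p : ℝ × ℝ => (⟨p.1, p.2⟩ : ℂ)) :=
    Complex.measurableEquivRealProd.symm.measurable
  rw [complexGaussian, lintegral_map hf hm]
  exact lintegral_prod _ (hf.comp hm).aemeasurable

lemma lintegral_gaussianReal_half_le (f : ℝ → ℝ≥0∞) (hf : Measurable f) :
    ∫⁻ x, f x ∂gaussianReal 0 (1 / 2) ≤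
      ENNReal.ofReal (Real.sqrt Real.pi)⁻¹ * ∫⁻ x, f x := by
  rw [gaussianReal_of_var_ne_zero _ (by norm_num),
    lintegral_withDensity_eq_lintegral_mul _ (measurable_gaussianPDF _ _) hf,
    ← lintegral_const_mul _ hf]
  refine lintegral_mono fun x => ?_
  simp only [Pi.mul_apply]
  gcongr
  rw [gaussianPDF, gaussianPDFReal]
  refine ENNReal.ofReal_le_ofReal ?_
  have : 2 * Real.pi * ((1 / 2 : ℝ≥0) : ℝ) = Real.pi := by push_cast; ring
  rw [this]
  refine mul_le_of_le_one_right (by positivity) (Real.exp_le_one_iff.2 ?_)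
  exact div_nonpos_of_nonpos_of_nonneg (neg_nonpos.2 (sq_nonneg _)) (by positivity)

/-- The density is at most its peak `1 / π`; passing to Lebesgue measure makes translation
invariance available. -/
lemma lintegral_complexGaussian_one_le {f : ℂ → ℝ≥0∞} (hf : Measurable f) :
    ∫⁻ z, f z ∂complexGaussian 1 ≤ ENNReal.ofReal Real.pi⁻¹ * ∫⁻ z, f z := by
  have hm : Measurable (fun p : ℝ × ℝ => (⟨p.1, p.2⟩ : ℂ)) :=
    Complex.measurableEquivRealProd.symm.measurable
  rw [lintegral_complexGaussian 1 hf]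
  have hv : ∫⁻ z, f z = ∫⁻ x : ℝ, ∫⁻ y : ℝ, f ⟨x, y⟩ := by
    rw [← (Complex.volume_preserving_equiv_real_prod.symm).lintegral_comp hf,
      Measure.volume_eq_prod]
    exact lintegral_prod _ (hf.comp hm).aemeasurable
  have hc : ENNReal.ofReal Real.pi⁻¹ =
      ENNReal.ofReal (Real.sqrt Real.pi)⁻¹ * ENNReal.ofReal (Real.sqrt Real.pi)⁻¹ := by
    rw [← ENNReal.ofReal_mul (by positivity), ← mul_inv, Real.mul_self_sqrt Real.pi_pos.le]
  have hx (x : ℝ) : Measurable fun y : ℝ => f ⟨x, y⟩ := hf.comp (hm.comp measurable_prodMk_left)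
  have hi : Measurable fun x : ℝ => ∫⁻ y : ℝ, f ⟨x, y⟩ :=
    (hf.comp hm).lintegral_prod_right'
  rw [hv, hc, mul_assoc, ← lintegral_const_mul _ hi]
  refine (lintegral_mono fun x => lintegral_gaussianReal_half_le _ (hx x)).trans ?_
  exact lintegral_gaussianReal_half_le _ (hi.const_mul _)

instance nullSingletonClass_complexGaussian_one : NullSingletonClass (complexGaussian 1) where
  measure_singleton z := by
    have h := lintegral_complexGaussian_one_le
      (f := Set.indicator {z} 1) (measurable_one.indicator (measurableSet_singleton z))
    rw [lintegral_indicator_one (measurableSet_singleton z),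
      lintegral_indicator_one (measurableSet_singleton z),
      measure_singleton (μ := (volume : Measure ℂ)), mul_zero] at h
    exact nonpos_iff_eq_zero.1 h

/-- After domination by Lebesgue measure, a translation removes `β` and a Gaussian integral remains.
Uniformity in `β` is what allows all other coordinates to be frozen. -/
lemma lintegral_exp_affine_le {κ : ℝ} (hκ : 0 < κ) {α : ℂ} (hα : α ≠ 0) (β : ℂ) :
    ∫⁻ z, ENNReal.ofReal (Real.exp (-κ * ‖z * α + β‖ ^ 2)) ∂complexGaussian 1 ≤
      ENNReal.ofReal (κ * ‖α‖ ^ 2)⁻¹ := by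
  have hα' : 0 < ‖α‖ := norm_pos_iff.2 hα
  have hb : 0 < κ * ‖α‖ ^ 2 := by positivity
  have e (z : ℂ) : -κ * ‖z * α + β‖ ^ 2 = -(κ * ‖α‖ ^ 2) * ‖z + β / α‖ ^ 2 := by
    have : z * α + β = (z + β / α) * α := by field_simp
    rw [this, norm_mul]; ring
  refine (lintegral_complexGaussian_one_le (by fun_prop)).trans ?_
  simp_rw [e]
  rw [lintegral_add_right_eq_self
    (fun z : ℂ => ENNReal.ofReal (Real.exp (-(κ * ‖α‖ ^ 2) * ‖z‖ ^ 2))) (β / α)]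
  have hI := GaussianFourier.integral_rexp_neg_mul_sq_norm (V := ℂ) hb
  rw [Complex.finrank_real_complex, Nat.cast_ofNat, div_self two_ne_zero, Real.rpow_one] at hI
  have hint : Integrable (fun z : ℂ => Real.exp (-(κ * ‖α‖ ^ 2) * ‖z‖ ^ 2)) :=
    .of_integral_ne_zero (by rw [hI]; positivity)
  rw [← ofReal_integral_eq_lintegral_ofReal hint (ae_of_all _ fun _ => (Real.exp_pos _).le), hI,
    ← ENNReal.ofReal_mul (by positivity)]
  refine le_of_eq (congrArg _ ?_)
  field_simp

lemma lintegral_exp_re_mul (e : ℂ) :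
    ∫⁻ z, ENNReal.ofReal (Real.exp (-(star e * z).re)) ∂complexGaussian 1 =
      ENNReal.ofReal (Real.exp (‖e‖ ^ 2 / 4)) := by
  have hg (t : ℝ) : ∫⁻ x, ENNReal.ofReal (Real.exp (t * x)) ∂gaussianReal 0 (1 / 2) =
      ENNReal.ofReal (Real.exp (t ^ 2 / 4)) := by
    rw [← ofReal_integral_eq_lintegral_ofReal (integrable_exp_mul_gaussianReal t)
      (ae_of_all _ fun _ => (Real.exp_pos _).le)]
    have := congrFun (mgf_id_gaussianReal (μ := 0) (v := 1 / 2)) t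
    simp only [mgf, id] at this
    rw [this]
    congr 2
    push_cast; ring
  rw [lintegral_complexGaussian 1 (by fun_prop)]
  have e1 (x y : ℝ) : ENNReal.ofReal (Real.exp (-(star e * ⟨x, y⟩).re)) =
      ENNReal.ofReal (Real.exp (-e.re * x)) * ENNReal.ofReal (Real.exp (-e.im * y)) := by
    rw [← ENNReal.ofReal_mul (Real.exp_pos _).le, ← Real.exp_add]
    congr 2
    simp; ring
  have e2 (x : ℝ) : ∫⁻ y, ENNReal.ofReal (Real.exp (-(star e * ⟨x, y⟩).re))
      ∂gaussianReal 0 (1 / 2) =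
      ENNReal.ofReal (Real.exp (-e.re * x)) * ENNReal.ofReal (Real.exp ((-e.im) ^ 2 / 4)) := by
    rw [← hg, ← lintegral_const_mul' _ _ ENNReal.ofReal_ne_top]
    exact lintegral_congr (e1 x)
  rw [lintegral_congr e2, lintegral_mul_const' _ _ ENNReal.ofReal_ne_top, hg]
  rw [← ENNReal.ofReal_mul (Real.exp_pos _).le, ← Real.exp_add, ← Complex.normSq_eq_norm_sq,
    Complex.normSq_apply]
  congr 2; ring

/-! ### Partial integration over product measures -/

section Marginal

variable {ι : Type*} [Fintype ι] {X : Type*} [MeasurableSpace X]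
  {γ : Measure X} [IsProbabilityMeasure γ]

lemma lintegral_pi_prod (F : ι → X → ℝ≥0∞) (hF : ∀ i, Measurable (F i)) :
    ∫⁻ y, ∏ i, F i (y i) ∂Measure.pi (fun _ : ι => γ) = ∏ i, ∫⁻ x, F i x ∂γ := by
  have h := lintegral_prod_eq_prod_lintegral_of_indepFun (μ := Measure.pi fun _ : ι => γ)
    Finset.univ (fun i y => F i (y i)) (iIndepFun_pi fun i => (hF i).aemeasurable)
    (fun i => (hF i).comp (measurable_pi_apply i))
  rw [h]
  exact Finset.prod_congr rfl fun i _ =>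
    (measurePreserving_eval (fun _ : ι => γ) i).lintegral_comp (hF i)

variable [DecidableEq ι] in
/-- Integrate out the coordinates in `T`. -/
lemma lintegral_pi_le_of_marginal (T : Finset ι) {f h : (ι → X) → ℝ≥0∞} (hf : Measurable f)
    (hh : Measurable h) (hinv : ∀ z z', (∀ t ∉ T, z' t = z t) → h z' = h z)
    (hle : ∀ z, ∃ (K : ℝ≥0∞) (F : ι → X → ℝ≥0∞), (∀ t, Measurable (F t)) ∧
      (∀ z', (∀ t ∉ T, z' t = z t) → f z' ≤ K * ∏ t ∈ T, F t (z' t)) ∧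
      K * ∏ t ∈ T, ∫⁻ x, F t x ∂γ ≤ h z) :
    ∫⁻ z, f z ∂Measure.pi (fun _ : ι => γ) ≤ ∫⁻ z, h z ∂Measure.pi (fun _ : ι => γ) := by
  refine lintegral_le_of_lmarginal_le T hf hh fun z => ?_
  obtain ⟨K, F, hF, h1, h2⟩ := hle z
  have hz (y : T → X) : ∀ t ∉ T, Function.updateFinset z T y t = z t := fun t ht => by
    simp [Function.updateFinset, ht]
  have hr : (∫⋯∫⁻_T, h ∂fun _ => γ) z = h z := by
    simp [lmarginal, hinv _ _ (hz _)]
  rw [hr, lmarginal]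
  refine (lintegral_mono fun y => h1 _ (hz y)).trans ?_
  refine le_trans (le_of_eq ?_) h2
  have e1 (y : T → X) : ∏ t ∈ T, F t (Function.updateFinset z T y t) = ∏ t : T, F t (y t) := by
    rw [← Finset.prod_coe_sort]
    exact Finset.prod_congr rfl fun t _ => by simp [Function.updateFinset]
  simp_rw [e1]
  rw [lintegral_const_mul _ (by fun_prop), lintegral_pi_prod (fun t : T => F t) (fun t => hF t),
    Finset.prod_coe_sort T fun t => ∫⁻ x, F t x ∂γ]

end Marginal

/-- A square matrix with independent entries of atomless law is almost surely nonsingular. -/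
lemma ae_det_ne_zero {ι : Type*} [Fintype ι] [DecidableEq ι] {γ : Measure ℂ}
    [IsProbabilityMeasure γ] [NullSingletonClass γ] :
    ∀ (n : ℕ) (e : Fin n × Fin n → ι), Function.Injective e →
      ∀ᵐ z ∂Measure.pi (fun _ : ι => γ), (Matrix.of fun a b => z (e (a, b))).det ≠ 0 := by
  intro n
  induction n with
  | zero => simp
  | succ n ih =>
    intro e he
    have hd {m : ℕ} (e : Fin m × Fin m → ι) :
        Measurable fun z : ι → ℂ => (Matrix.of fun a b => z (e (a, b))).det :=
      (Continuous.matrix_det (by fun_prop)).measurable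
    have hs {m : ℕ} (e : Fin m × Fin m → ι) :
        MeasurableSet {z : ι → ℂ | (Matrix.of fun a b => z (e (a, b))).det = 0} :=
      hd e (measurableSet_singleton 0)
    let e' : Fin n × Fin n → ι := fun p => e (p.1.succ, p.2.succ)
    have he' : Function.Injective e' := fun p q h => by
      have := he h
      simp only [Prod.mk.injEq, Fin.succ_inj] at this
      exact Prod.ext this.1 this.2
    have hz := ih e' he'
    rw [ae_iff] at hz ⊢
    simp only [not_not] at hz ⊢
    rw [← nonpos_iff_eq_zero, ← hz, ← lintegral_indicator_one (hs e),
      ← lintegral_indicator_one (hs e')]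
    -- Integrating out the corner entry alone bounds the probability that the determinant vanishes
    -- by the probability that the complementary minor does, which is zero by induction.
    refine lintegral_le_of_lmarginal_le {e (0, 0)} (measurable_one.indicator (hs e))
      (measurable_one.indicator (hs e')) fun z => ?_
    rw [lmarginal_singleton, lmarginal_singleton]
    have hm (x : ℂ) : (Matrix.of fun a b => Function.update z (e (0, 0)) x (e' (a, b))) =
        Matrix.of fun a b => z (e' (a, b)) := by
      ext a b
      have : e' (a, b) ≠ e (0, 0) := fun h => by simpa using he h
      simp [this]
    by_cases h0 : (Matrix.of fun a b => z (e' (a, b))).det = 0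
    · refine lintegral_mono fun x => ?_
      rw [Set.indicator_of_mem 
        (s := {z : ι → ℂ | (Matrix.of fun a b => z (e' (a, b))).det = 0})
        (by rw [Set.mem_ofPred_eq, hm, h0])]
      exact Set.indicator_le_self' (fun _ _ => zero_le) _
    · let c : ℂ := ∑ b : Fin n, (-1) ^ (b.succ : ℕ) * z (e (0, b.succ)) *
        ((Matrix.of fun a b => z (e (a, b))).submatrix Fin.succ (b.succ.succAbove)).det
      -- The determinant is affine in the corner entry, with the minor as slope; for a nonzero minor
      -- it has a single root, a null set.
      have hx (x : ℂ) :
          (Matrix.of fun a b => Function.update z (e (0, 0)) x (e (a, b))).det =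
            x * (Matrix.of fun a b => z (e' (a, b))).det + c := by
        rw [Matrix.det_succ_row_zero, Fin.sum_univ_succ]
        congr 1
        · simp only [Fin.val_zero, pow_zero, one_mul, Matrix.of_apply, Function.update_self]
          rw [← hm x]
          rfl
        · refine Finset.sum_congr rfl fun b _ => ?_
          have h1 : e (0, b.succ) ≠ e (0, 0) := fun h => by simpa using he h
          simp only [Matrix.of_apply, Function.update_of_ne h1]
          congr 2
          ext a b'
          have h2 : e (a.succ, b.succ.succAbove b') ≠ e (0, 0) := fun h => by simpa using he h
          simp [Function.update_of_ne h2]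
      refine le_trans (le_of_eq ?_) (zero_le)
      have hset : ∀ x, Set.indicator {z : ι → ℂ | (Matrix.of fun a b => z (e (a, b))).det = 0}
          (1 : (ι → ℂ) → ℝ≥0∞) (Function.update z (e (0, 0)) x) ≤ Set.indicator
          {-c / (Matrix.of fun a b => z (e' (a, b))).det} 1 x := by
        intro x
        by_cases hxx : (Matrix.of fun a b => Function.update z (e (0, 0)) x (e (a, b))).det = 0
        · rw [hx] at hxx
          have : x = -c / (Matrix.of fun a b => z (e' (a, b))).det := by
            field_simp
            linear_combination hxx
          rw [Set.indicator_of_mem (s := {-c / (Matrix.of fun a b => z (e' (a, b))).det}) this]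
          exact Set.indicator_le_self' (fun _ _ => zero_le) _
        · rw [Set.indicator_of_notMem (by exact hxx)]
          exact zero_le
      refine le_antisymm ((lintegral_mono hset).trans ?_) (zero_le)
      rw [lintegral_indicator_one (measurableSet_singleton _), measure_singleton]

/-! ### Interference cancellation -/

lemma process_add (θ : ℝ) (j : Fin 2) (Y Z : Matrix (Fin 4) (Fin 6) ℂ) :
    process θ j (Y + Z) = process θ j Y + process θ j Z := by
  ext a b
  fin_cases j <;> fin_cases a <;> fin_cases b <;> simp [process] <;> ring

lemma process_smul (θ : ℝ) (j : Fin 2) (r : ℝ) (Y : Matrix (Fin 4) (Fin 6) ℂ) :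
    process θ j ((r : ℂ) • Y) = (r : ℂ) • process θ j Y := by
  ext a b
  fin_cases j <;> fin_cases a <;> fin_cases b <;> simp [process] <;> ring

/-- The columns borrowed for the correction terms are exactly the zero columns of `spread j`. -/
lemma process_mul_spread (θ : ℝ) (j : Fin 2) (A C : Matrix (Fin 4) (Fin 4) ℂ) :
    process θ j (A * spread j C) = A * C := by
  ext a b
  fin_cases j <;> fin_cases a <;> fin_cases b <;>
    simp [process, spread, Matrix.mul_apply, Fin.sum_univ_four]

/-- Within each Alamouti block one column is, up to signs and row swap, the conjugate of the other.
Blocks carrying the phase `e` need the factor `w = e²`, because `w * star e = e`. -/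
lemma process_spread_rev (θ : ℝ) (j : Fin 2) (x : Fin 8 → ℂ) :
    process θ j (spread j.rev (srCode θ x)) = 0 := by
  have hw : Complex.exp (Complex.I * (2 * θ)) * star (Complex.exp (Complex.I * θ)) =
      Complex.exp (Complex.I * θ) := by
    rw [Complex.star_def, ← Complex.exp_conj, ← Complex.exp_add]
    congr 1
    simp
    ring
  have h0 : (0 : Fin 2).rev = 1 := rfl
  have h1 : (1 : Fin 2).rev = 0 := rfl
  generalize hW : Complex.exp (Complex.I * (2 * θ)) = w at hw
  generalize hE : Complex.exp (Complex.I * θ) = e at hw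
  have hwe (u : ℂ) : w * ((starRingEnd ℂ) e * u) = e * u := by
    rw [← mul_assoc, ← Complex.star_def, hw]
  ext a b
  fin_cases j <;> fin_cases a <;> fin_cases b <;>
    simp [process, spread, srCode, h0, h1, hW, hE, hwe]

lemma mul_precoder_rev (H : Channels) (i j : Fin 2) :
    ∃ r : ℝ, H i j * precoder H i j.rev = (r : ℂ) • (1 : Matrix (Fin 4) (Fin 4) ℂ) := by
  by_cases h : IsUnit (H i j).det
  · refine ⟨(Real.sqrt ((H i j)⁻¹ * ((H i j)⁻¹)ᴴ).trace.re)⁻¹, ?_⟩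
    simp only [precoder, Fin.rev_rev]
    rw [Matrix.mul_smul, Matrix.mul_nonsing_inv _ h]
  -- A singular matrix has inverse zero by convention, so the precoder vanishes.
  · refine ⟨0, ?_⟩
    simp [precoder, Fin.rev_rev, Matrix.nonsing_inv_apply_not_isUnit _ h]

/-- Interference cancellation is exact, even where a channel matrix is singular. -/
lemma process_received (θ P : ℝ) (H : Channels) (x : Fin 2 → Fin 2 → Fin 8 → ℂ) (j : Fin 2)
    (N : Matrix (Fin 4) (Fin 6) ℂ) :
    process θ j (received θ P H x j N) =
      signal θ P H j (fun i => x i j) + process θ j N := by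
  have hj (f : Fin 2 → Matrix (Fin 4) (Fin 6) ℂ) : ∑ k, f k = f j + f j.rev := by
    fin_cases j
    · simp [Fin.sum_univ_two]
    · rw [Fin.sum_univ_two, add_comm]; rfl
  have hi (i : Fin 2) : process θ j (H i j * transmitted θ P H x i) =
      (Real.sqrt (3 * P / 4) : ℂ) • (H i j * precoder H i j * srCode θ (x i j)) := by
    obtain ⟨r, hr⟩ := mul_precoder_rev H i j
    rw [transmitted, hj, Matrix.mul_smul, process_smul, Matrix.mul_add, process_add,
      ← Matrix.mul_assoc, ← Matrix.mul_assoc, process_mul_spread, hr, Matrix.smul_mul,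
      Matrix.one_mul, process_smul, process_spread_rev, smul_zero, add_zero]
  rw [received, process_add, signal, Fin.sum_univ_two, process_add, hi, hi, Fin.sum_univ_two,
    smul_add]

/-! ### The pairwise error event -/

/-- The effective noiseless output at unit gain for the code matrices `M i`. -/
noncomputable def combined (H : Channels) (j : Fin 2) (M : Fin 2 → Matrix (Fin 4) (Fin 4) ℂ) :
    Matrix (Fin 4) (Fin 4) ℂ :=
  ∑ i, H i j * precoder H i j * M i

lemma signal_sub (θ P : ℝ) (H : Channels) (j : Fin 2) (s t : Fin 2 → Fin 8 → ℂ) :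
    signal θ P H j s - signal θ P H j t = (Real.sqrt (3 * P / 4) : ℂ) •
      combined H j (fun i => srCode θ (s i) - srCode θ (t i)) := by
  simp only [signal, combined, Matrix.mul_sub, Finset.sum_sub_distrib, smul_sub]

lemma noiseVar_pos (j : Fin 2) (b : Fin 4) : 0 < noiseVar j b := by
  fin_cases j <;> fin_cases b <;> simp [noiseVar]

lemma noiseVar_le (j : Fin 2) (b : Fin 4) : noiseVar j b ≤ 2 := by
  fin_cases j <;> fin_cases b <;> simp [noiseVar]

lemma likelihood_eq (θ P : ℝ) (H : Channels) (j : Fin 2) (Y : Matrix (Fin 4) (Fin 4) ℂ)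
    (d : Fin 2 → Fin 8 → ℂ) :
    likelihood θ P H j Y d = (∏ _a : Fin 4, ∏ b, (Real.pi * noiseVar j b)⁻¹) *
      Real.exp (-∑ a, ∑ b, ‖Y a b - signal θ P H j d a b‖ ^ 2 / noiseVar j b) := by
  simp only [likelihood, complexGaussianPDF, Finset.prod_mul_distrib, ← Real.exp_sum,
    ← Finset.sum_neg_distrib, neg_div]

lemma likelihood_le_iff (θ P : ℝ) (H : Channels) (j : Fin 2) (Y : Matrix (Fin 4) (Fin 4) ℂ)
    (s t : Fin 2 → Fin 8 → ℂ) :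
    likelihood θ P H j Y s ≤ likelihood θ P H j Y t ↔
      ∑ a, ∑ b, ‖Y a b - signal θ P H j t a b‖ ^ 2 / noiseVar j b ≤
        ∑ a, ∑ b, ‖Y a b - signal θ P H j s a b‖ ^ 2 / noiseVar j b := by
  have hpos : 0 < ∏ _a : Fin 4, ∏ b, (Real.pi * noiseVar j b)⁻¹ :=
    Finset.prod_pos fun _ _ => Finset.prod_pos fun b _ =>
      inv_pos.2 (mul_pos Real.pi_pos (noiseVar_pos j b))
  rw [likelihood_eq, likelihood_eq, mul_le_mul_iff_right₀ hpos, Real.exp_le_exp, neg_le_neg_iff]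

/-- Squared distance between noiseless outputs, weighted by the noise variances. -/
noncomputable def weightedNormSq (j : Fin 2) (D : Matrix (Fin 4) (Fin 4) ℂ) : ℝ :=
  ∑ a, ∑ b, ‖D a b‖ ^ 2 / noiseVar j b

/-- The adjoint of `process` for the real inner product weighted by the noise variances. -/
noncomputable def processAdjoint (θ : ℝ) (j : Fin 2) (D : Matrix (Fin 4) (Fin 4) ℂ) :
    Matrix (Fin 4) (Fin 6) ℂ :=
  let w : ℂ := Complex.exp (Complex.I * (2 * θ))
  match j with
  | 0 =>
    !![D 0 0, D 0 1 / 2, star (D 1 1) / 2, D 0 2, D 0 3 / 2, w * star (D 1 3) / 2;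
       D 1 0, D 1 1 / 2, -star (D 0 1) / 2, D 1 2, D 1 3 / 2, -w * star (D 0 3) / 2;
       D 2 0, D 2 1 / 2, w * star (D 3 1) / 2, D 2 2, D 2 3 / 2, star (D 3 3) / 2;
       D 3 0, D 3 1 / 2, -w * star (D 2 1) / 2, D 3 2, D 3 3 / 2, -star (D 2 3) / 2]
  | 1 =>
    !![-star (D 1 0) / 2, D 0 0 / 2, D 0 1, -w * star (D 1 2) / 2, D 0 2 / 2, D 0 3;
       star (D 0 0) / 2, D 1 0 / 2, D 1 1, w * star (D 0 2) / 2, D 1 2 / 2, D 1 3;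
       -w * star (D 3 0) / 2, D 2 0 / 2, D 2 1, -star (D 3 2) / 2, D 2 2 / 2, D 2 3;
       w * star (D 2 0) / 2, D 3 0 / 2, D 3 1, star (D 2 2) / 2, D 3 2 / 2, D 3 3]

lemma sum_re_processAdjoint (θ : ℝ) (j : Fin 2) (D : Matrix (Fin 4) (Fin 4) ℂ)
    (N : Matrix (Fin 4) (Fin 6) ℂ) :
    ∑ a, ∑ b, (star (D a b) * process θ j N a b).re / noiseVar j b =
      ∑ a, ∑ b, (star (processAdjoint θ j D a b) * N a b).re := by
  fin_cases j <;>
    simp [process, processAdjoint, noiseVar, Fin.sum_univ_four, Fin.sum_univ_six] <;> ring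

/-- An entry in a column of variance 2 occurs twice in the adjoint, halved and up to unit-modulus
factors and conjugation, contributing `2 * (1 / 4) = 1 / 2` of its squared norm. This replaces any
computation of the law of the processed noise. -/
lemma sum_normSq_processAdjoint (θ : ℝ) (j : Fin 2) (D : Matrix (Fin 4) (Fin 4) ℂ) :
    ∑ a, ∑ b, ‖processAdjoint θ j D a b‖ ^ 2 = weightedNormSq j D := by
  have hw : ‖Complex.exp (Complex.I * (2 * θ))‖ = 1 := by
    simp [Complex.norm_exp]
  fin_cases j <;>
    simp [processAdjoint, weightedNormSq, noiseVar, Fin.sum_univ_four, Fin.sum_univ_six, hw] <;>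
    ring

/-- The common normalisation cancels, leaving weighted least squares: the event compares `D` plus
processed noise with the processed noise alone, and expanding the square leaves the cross term. -/
lemma pairwise_event_iff (θ P : ℝ) (H : Channels) (x : Fin 2 → Fin 2 → Fin 8 → ℂ) (j : Fin 2)
    (N : Matrix (Fin 4) (Fin 6) ℂ) (d : Fin 2 → Fin 8 → ℂ) {D : Matrix (Fin 4) (Fin 4) ℂ}
    (hD : signal θ P H j (fun i => x i j) - signal θ P H j d = D) :
    likelihood θ P H j (process θ j (received θ P H x j N)) (fun i => x i j) ≤
        likelihood θ P H j (process θ j (received θ P H x j N)) d ↔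
      weightedNormSq j D + 2 * ∑ a, ∑ b, (star (processAdjoint θ j D a b) * N a b).re ≤ 0 := by
  rw [likelihood_le_iff, process_received, ← sum_re_processAdjoint, weightedNormSq,
    ← sub_nonpos]
  refine iff_of_eq (congrArg (· ≤ (0 : ℝ)) ?_)
  simp only [Finset.mul_sum, ← Finset.sum_sub_distrib, ← Finset.sum_add_distrib]
  refine Finset.sum_congr rfl fun a _ => Finset.sum_congr rfl fun b _ => ?_
  have h1 : (signal θ P H j (fun i => x i j) + process θ j N) a b - signal θ P H j d a b =
      D a b + process θ j N a b := by
    simp only [← hD, Matrix.add_apply, Matrix.sub_apply]; ring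
  have h2 : (signal θ P H j (fun i => x i j) + process θ j N) a b -
      signal θ P H j (fun i => x i j) a b = process θ j N a b := by
    simp only [Matrix.add_apply]; ring
  rw [h1, h2]
  simp only [← Complex.normSq_eq_norm_sq, Complex.normSq_apply]
  simp
  ring

/-! ### Frobenius norms -/

lemma sum_normSq_eq_trace (A : Matrix (Fin 4) (Fin 4) ℂ) :
    ∑ a, ∑ b, ‖A a b‖ ^ 2 = (A * Aᴴ).trace.re := by
  simp only [Matrix.trace, Matrix.diag_apply, Matrix.mul_apply, Matrix.conjTranspose_apply,
    Complex.re_sum]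
  refine Finset.sum_congr rfl fun a _ => Finset.sum_congr rfl fun b _ => ?_
  rw [Complex.star_def, Complex.mul_conj, Complex.ofReal_re, Complex.normSq_eq_norm_sq]

lemma sum_normSq_precoder {H : Channels} {i j : Fin 2} (h : (H i j.rev).det ≠ 0) :
    ∑ a, ∑ b, ‖precoder H i j a b‖ ^ 2 = 1 := by
  have hA : 0 < ∑ a, ∑ b, ‖(H i j.rev)⁻¹ a b‖ ^ 2 := by
    by_contra hn
    have h0 : ∑ a, ∑ b, ‖(H i j.rev)⁻¹ a b‖ ^ 2 = 0 :=
      le_antisymm (not_lt.1 hn) (by positivity)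
    have hz : (H i j.rev)⁻¹ = 0 := by
      ext a b
      rw [Finset.sum_eq_zero_iff_of_nonneg (fun _ _ => by positivity)] at h0
      have := h0 a (Finset.mem_univ a)
      rw [Finset.sum_eq_zero_iff_of_nonneg (fun _ _ => by positivity)] at this
      simpa using this b (Finset.mem_univ b)
    have := Matrix.mul_nonsing_inv _ (isUnit_iff_ne_zero.2 h)
    rw [hz, mul_zero] at this
    exact zero_ne_one this
  simp only [precoder, Matrix.smul_apply, smul_eq_mul, norm_mul, mul_pow, ← Finset.mul_sum,
    ← sum_normSq_eq_trace, Complex.norm_real, Real.norm_eq_abs, sq_abs]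
  rw [inv_pow, Real.sq_sqrt hA.le, inv_mul_cancel₀ hA.ne']

attribute [local instance] Matrix.frobeniusNormedAddCommGroup in
lemma sum_normSq_mul_le (A B : Matrix (Fin 4) (Fin 4) ℂ) :
    ∑ a, ∑ b, ‖(A * B) a b‖ ^ 2 ≤ (∑ a, ∑ b, ‖A a b‖ ^ 2) * ∑ a, ∑ b, ‖B a b‖ ^ 2 := by
  have e (M : Matrix (Fin 4) (Fin 4) ℂ) : ∑ a, ∑ b, ‖M a b‖ ^ 2 = ‖M‖ ^ 2 := by
    rw [Matrix.frobenius_norm_def, ← Real.sqrt_eq_rpow, Real.sq_sqrt (by positivity)]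
    simp
  rw [e, e, e, ← mul_pow]
  gcongr
  exact Matrix.frobenius_norm_mul A B

/-- If all 16 entries were smaller, `‖V * M‖² < 1 / B`, and `V = (V * M) * M⁻¹` would have norm
below 1. -/
lemma exists_le_normSq_mul {V M : Matrix (Fin 4) (Fin 4) ℂ}
    (hV : ∑ a, ∑ b, ‖V a b‖ ^ 2 = 1) (hM : M.det ≠ 0) {B : ℝ} (hB : 0 < B)
    (hMB : ∑ a, ∑ b, ‖M⁻¹ a b‖ ^ 2 ≤ B) :
    ∃ a b, (16 * B)⁻¹ ≤ ‖(V * M) a b‖ ^ 2 := by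
  by_contra! hn
  have h1 : ∑ a, ∑ b, ‖(V * M) a b‖ ^ 2 < B⁻¹ := by
    calc _ < ∑ _a : Fin 4, ∑ _b : Fin 4, (16 * B)⁻¹ :=
          Finset.sum_lt_sum_of_nonempty Finset.univ_nonempty fun a _ =>
            Finset.sum_lt_sum_of_nonempty Finset.univ_nonempty fun b _ => hn a b
      _ = B⁻¹ := by simp; field_simp; norm_num
  have h2 := sum_normSq_mul_le (V * M) M⁻¹
  rw [Matrix.mul_assoc, Matrix.mul_nonsing_inv _ (isUnit_iff_ne_zero.2 hM), mul_one, hV] at h2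
  have h3 : (∑ a, ∑ b, ‖(V * M) a b‖ ^ 2) * ∑ a, ∑ b, ‖M⁻¹ a b‖ ^ 2 ≤
      (∑ a, ∑ b, ‖(V * M) a b‖ ^ 2) * B := by gcongr
  have h4 : (∑ a, ∑ b, ‖(V * M) a b‖ ^ 2) * B < B⁻¹ * B := by gcongr
  rw [inv_mul_cancel₀ hB.ne'] at h4
  linarith

/-! ### The joint law of channels and noise -/

/-- Index of the entries of all channel matrices and of the noise matrix. -/
abbrev Coord := (Fin 2 × Fin 2 × Fin 4 × Fin 4) ⊕ (Fin 4 × Fin 6)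

/-- Joint law of the entries of all channel matrices and of the noise matrix. -/
noncomputable abbrev rayleighLaw : Measure (Coord → ℂ) := Measure.pi fun _ => complexGaussian 1

/-- The channel matrices with given entries. -/
def chan (z : Coord → ℂ) : Channels := fun i j => Matrix.of fun a b => z (Sum.inl (i, j, a, b))

/-- The noise matrix with given entries. -/
def noise (z : Coord → ℂ) : Matrix (Fin 4) (Fin 6) ℂ := Matrix.of fun a b => z (Sum.inr (a, b))

lemma measurable_precoder (i j : Fin 2) (a b : Fin 4) :
    Measurable fun z => precoder (chan z) i j a b := by
  have hc : Continuous fun z => chan z i j.rev :=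
    continuous_matrix fun a b => continuous_apply (Sum.inl (i, j.rev, a, b))
  have hinv (a b : Fin 4) : Measurable fun z => (chan z i j.rev)⁻¹ a b := by
    simp only [Matrix.inv_def, Ring.inverse_eq_inv', Matrix.smul_apply, smul_eq_mul]
    exact hc.matrix_det.measurable.inv.mul (hc.matrix_adjugate.matrix_elem a b).measurable
  simp only [precoder, ← sum_normSq_eq_trace, Matrix.smul_apply, smul_eq_mul]
  have hs : Measurable fun z => ∑ a, ∑ b, ‖(chan z i j.rev)⁻¹ a b‖ ^ 2 :=
    Finset.measurable_sum _ fun a _ => Finset.measurable_sum _ fun b _ =>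
      (hinv a b).norm.pow_const 2
  exact (Complex.measurable_ofReal.comp hs.sqrt.inv).mul (hinv a b)

lemma measurable_precoder_mul (i j : Fin 2) (M : Matrix (Fin 4) (Fin 4) ℂ) (a b : Fin 4) :
    Measurable fun z => (precoder (chan z) i j * M) a b := by
  simp only [Matrix.mul_apply]
  exact Finset.measurable_sum _ fun c _ => (measurable_precoder i j a c).mul_const _

lemma combined_apply (H : Channels) (j : Fin 2) (M : Fin 2 → Matrix (Fin 4) (Fin 4) ℂ)
    (a b : Fin 4) :
    combined H j M a b = ∑ i, ∑ c, H i j a c * (precoder H i j * M i) c b := by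
  simp only [combined, Matrix.sum_apply, Matrix.mul_assoc]
  exact Finset.sum_congr rfl fun i _ => Matrix.mul_apply

lemma measurable_combined (j : Fin 2) (M : Fin 2 → Matrix (Fin 4) (Fin 4) ℂ) (a b : Fin 4) :
    Measurable fun z => combined (chan z) j M a b := by
  simp only [combined_apply]
  exact Finset.measurable_sum _ fun i _ => Finset.measurable_sum _ fun c _ =>
    (measurable_pi_apply (Sum.inl (i, j, a, c))).mul (measurable_precoder_mul i j (M i) c b)

lemma precoder_congr {H H' : Channels} {i j : Fin 2} (h : H' i j.rev = H i j.rev) :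
    precoder H' i j = precoder H i j := by
  simp only [precoder, h]

/-- How the combined output depends on column `p` of one direct channel matrix. -/
lemma combined_eq_add {H H' : Channels} {i₀ j : Fin 2} {p : Fin 4}
    (h : ∀ i l a c, (i, l, c) ≠ (i₀, j, p) → H' i l a c = H i l a c)
    (M : Fin 2 → Matrix (Fin 4) (Fin 4) ℂ) (a b : Fin 4) :
    combined H' j M a b = combined H j M a b +
      (H' i₀ j a p - H i₀ j a p) * (precoder H i₀ j * M i₀) p b := by
  have hV (i : Fin 2) : precoder H' i j = precoder H i j := by
    refine precoder_congr (Matrix.ext fun a c => h _ _ _ _ fun hh => ?_)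
    have : j.rev = j := congrArg (fun t => t.2.1) hh
    fin_cases j <;> simp at this
  rw [← sub_eq_iff_eq_add', combined_apply, combined_apply, ← Finset.sum_sub_distrib]
  simp only [← Finset.sum_sub_distrib, hV, ← sub_mul]
  rw [Finset.sum_eq_single i₀, Finset.sum_eq_single p]
  · intro c _ hc
    rw [h _ _ _ _ (by simp [hc]), sub_self, zero_mul]
  · simp
  · intro i _ hi
    exact Finset.sum_eq_zero fun c _ => by rw [h _ _ _ _ (by simp [hi]), sub_self, zero_mul]
  · simp

/-! ### Averaging over the noise -/

lemma measurable_weightedNormSq {α : Type*} [MeasurableSpace α]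
    {D : α → Matrix (Fin 4) (Fin 4) ℂ} (hD : ∀ a b, Measurable fun z => D z a b) (j : Fin 2) :
    Measurable fun z => weightedNormSq j (D z) :=
  Finset.measurable_sum _ fun a _ => Finset.measurable_sum _ fun b _ =>
    ((hD a b).norm.pow_const 2).div_const _

lemma measurable_processAdjoint {α : Type*} [MeasurableSpace α]
    {D : α → Matrix (Fin 4) (Fin 4) ℂ} (hD : ∀ a b, Measurable fun z => D z a b)
    (θ : ℝ) (j : Fin 2) (a : Fin 4) (b : Fin 6) :
    Measurable fun z => processAdjoint θ j (D z) a b := by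
  have hs (a b) : Measurable fun z => star (D z a b) := continuous_star.measurable.comp (hD a b)
  fin_cases j <;> fin_cases a <;> fin_cases b <;> simp [processAdjoint] <;> fun_prop

/-- The Chernoff exponent of the pairwise error event. -/
noncomputable def chernoffExponent (θ : ℝ) (j : Fin 2) (D : Matrix (Fin 4) (Fin 4) ℂ)
    (N : Matrix (Fin 4) (Fin 6) ℂ) : ℝ :=
  -(weightedNormSq j D / 2) - ∑ a, ∑ b, (star (processAdjoint θ j D a b) * N a b).re

lemma measurable_chernoffExponent {D : (Coord → ℂ) → Matrix (Fin 4) (Fin 4) ℂ}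
    (hD : ∀ a b, Measurable fun z => D z a b) (θ : ℝ) (j : Fin 2) :
    Measurable fun z => chernoffExponent θ j (D z) (noise z) :=
  ((measurable_weightedNormSq hD j).div_const 2).neg.sub <|
    Finset.measurable_sum _ fun a _ => Finset.measurable_sum _ fun b _ =>
      Complex.measurable_re.comp
        ((continuous_star.measurable.comp (measurable_processAdjoint hD θ j a b)).mul (measurable_pi_apply (Sum.inr (a, b))))

/-- With Chernoff parameter `λ` the noise average is `exp (-λ W + λ² W)`; the exponent used here is
the optimal `λ = 1 / 2`. Since `D` depends on the channels only, the noise entries can be integrated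
out separately. -/
lemma lintegral_exp_chernoffExponent_le {D : (Coord → ℂ) → Matrix (Fin 4) (Fin 4) ℂ}
    (hD : ∀ a b, Measurable fun z => D z a b)
    (hinv : ∀ z z', (∀ c, z' (Sum.inl c) = z (Sum.inl c)) → D z' = D z) (θ : ℝ) (j : Fin 2) :
    ∫⁻ z, ENNReal.ofReal (Real.exp (chernoffExponent θ j (D z) (noise z))) ∂rayleighLaw ≤
      ∫⁻ z, ENNReal.ofReal (Real.exp (-(weightedNormSq j (D z) / 4))) ∂rayleighLaw := by
  let T : Finset Coord := Finset.univ.image Sum.inr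
  have hT {z z' : Coord → ℂ} (h : ∀ t ∉ T, z' t = z t) : D z' = D z :=
    hinv _ _ fun c => h _ (by simp [T])
  have hprod (F : Coord → ℝ≥0∞) : ∏ t ∈ T, F t = ∏ a, ∏ b, F (Sum.inr (a, b)) := by
    rw [Finset.prod_image (Sum.inr_injective.injOn), Fintype.prod_prod_type]
  refine lintegral_pi_le_of_marginal T
    (measurable_chernoffExponent hD θ j).exp.ennreal_ofReal
    ((measurable_weightedNormSq hD j).div_const 4).neg.exp.ennreal_ofReal
    (fun z z' h => by rw [hT h]) fun z => ?_
  refine ⟨ENNReal.ofReal (Real.exp (-(weightedNormSq j (D z) / 2))),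
    Sum.elim (fun _ _ => 1) fun c u =>
      ENNReal.ofReal (Real.exp (-(star (processAdjoint θ j (D z) c.1 c.2) * u).re)),
    ?_, ?_, ?_⟩
  · rintro (_ | c)
    · exact measurable_const
    · exact (Measurable.ennreal_ofReal (by fun_prop))
  · intro z' hz'
    rw [hprod, hT hz', chernoffExponent]
    simp only [Sum.elim_inr]
    rw [sub_eq_add_neg, Real.exp_add, ENNReal.ofReal_mul (Real.exp_pos _).le]
    simp only [← Finset.sum_neg_distrib, Real.exp_sum]
    rw [ENNReal.ofReal_prod_of_nonneg fun _ _ => by positivity]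
    simp only [ENNReal.ofReal_prod_of_nonneg fun _ _ => (Real.exp_pos _).le]
    exact le_rfl
  · rw [hprod]
    simp only [Sum.elim_inr, lintegral_exp_re_mul]
    simp only [← ENNReal.ofReal_prod_of_nonneg fun _ _ => (Real.exp_pos _).le]
    rw [← ENNReal.ofReal_prod_of_nonneg fun _ _ => by positivity,
      ← ENNReal.ofReal_mul (Real.exp_pos _).le]
    simp only [← Real.exp_sum, ← Real.exp_add, ← Finset.sum_div, sum_normSq_processAdjoint]
    refine le_of_eq ?_
    congr 2
    ring

/-! ### Averaging over the channels -/

/-- Only column `p` of the direct channel of `i₀` is integrated. The precoders do not see it, so the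
slope and the indicator stay fixed, and each of the four rows gives one factor `1 / (κ τ)`. -/
lemma lintegral_exp_combined_column_le {κ τ : ℝ} (hκ : 0 < κ) (hτ : 0 < τ) (i₀ j : Fin 2)
    (M : Fin 2 → Matrix (Fin 4) (Fin 4) ℂ) (p k : Fin 4) :
    ∫⁻ z, {z | τ ≤ ‖(precoder (chan z) i₀ j * M i₀) p k‖ ^ 2}.indicator
      (fun z => ∏ a, ENNReal.ofReal (Real.exp (-κ * ‖combined (chan z) j M a k‖ ^ 2))) z
        ∂rayleighLaw ≤ ENNReal.ofReal (κ * τ)⁻¹ ^ 4 := by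
  let e : Fin 4 → Coord := fun a => Sum.inl (i₀, j, a, p)
  have he : Function.Injective e := fun a b h => by simpa [e] using h
  let T : Finset Coord := Finset.univ.image e
  have hprod (F : Coord → ℝ≥0∞) : ∏ t ∈ T, F t = ∏ a, F (e a) := by
    rw [Finset.prod_image he.injOn]
  -- The value on noise coordinates is irrelevant: `T` contains only channel entries.
  let row : Coord → Fin 4 := Sum.elim (fun c => c.2.2.1) (fun _ => 0)
  have hsame {z z' : Coord → ℂ} (h : ∀ t ∉ T, z' t = z t) (i l a c)
      (hne : (i, l, c) ≠ (i₀, j, p)) : chan z' i l a c = chan z i l a c := by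
    refine h _ fun hm => hne ?_
    obtain ⟨b, -, hb⟩ := Finset.mem_image.1 hm
    simp only [e, Sum.inl.injEq, Prod.mk.injEq] at hb
    simp [hb]
  have hV {z z' : Coord → ℂ} (h : ∀ t ∉ T, z' t = z t) :
      precoder (chan z') i₀ j = precoder (chan z) i₀ j := by
    refine precoder_congr (Matrix.ext fun a c => hsame h _ _ _ _ fun hh => ?_)
    have : j.rev = j := congrArg (fun t => t.2.1) hh
    fin_cases j <;> simp at this
  have hS : MeasurableSet {z | τ ≤ ‖(precoder (chan z) i₀ j * M i₀) p k‖ ^ 2} :=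
    measurableSet_le measurable_const ((measurable_precoder_mul i₀ j (M i₀) p k).norm.pow_const 2)
  have hmeas : Measurable fun z =>
      ∏ a, ENNReal.ofReal (Real.exp (-κ * ‖combined (chan z) j M a k‖ ^ 2)) :=
    Finset.measurable_prod _ fun a _ =>
      (((measurable_combined j M a k).norm.pow_const 2).const_mul _).exp.ennreal_ofReal
  refine (lintegral_pi_le_of_marginal T (hmeas.indicator hS) measurable_const
    (fun _ _ _ => rfl) (h := fun _ => ENNReal.ofReal (κ * τ)⁻¹ ^ 4) fun z => ?_).trans
      (by simp)
  set α := (precoder (chan z) i₀ j * M i₀) p k with hα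
  by_cases hz : τ ≤ ‖α‖ ^ 2
  · have hα0 : α ≠ 0 := fun h => by simp [h] at hz; linarith
    -- The offset is the current output with the contribution of the integrated entry removed.
    refine ⟨1, fun t u => ENNReal.ofReal (Real.exp (-κ *
      ‖u * α + (combined (chan z) j M (row t) k - z t * α)‖ ^ 2)), fun t => by fun_prop,
      fun z' h => ?_, ?_⟩
    · rw [hprod, one_mul]
      refine (Set.indicator_le_self _ _ _).trans (le_of_eq ?_)
      refine Finset.prod_congr rfl fun a _ => ?_
      change ENNReal.ofReal _ = ENNReal.ofReal (Real.exp (-κ *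
        ‖chan z' i₀ j a p * α + (combined (chan z) j M a k - chan z i₀ j a p * α)‖ ^ 2))
      rw [combined_eq_add (hsame h) M a k, ← hα]
      congr 5
      ring
    · rw [hprod, one_mul]
      refine (Finset.prod_le_prod' fun a _ => lintegral_exp_affine_le hκ hα0 _).trans ?_
      rw [Finset.prod_const, Finset.card_univ, Fintype.card_fin]
      gcongr
  · refine ⟨0, fun _ _ => 1, fun _ => measurable_const, fun z' h => ?_, by simp⟩
    rw [Set.indicator_of_notMem]
    · simp
    · simpa [hV h, ← hα] using hz

/-- The position of the large entry of the precoded code difference is random, so the integrand is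
dominated by a sum over all 16 positions, keeping only column `k` of the output in each term. -/
lemma lintegral_exp_combined_le {κ B : ℝ} (hκ : 0 < κ) (hB : 0 < B) (i₀ j : Fin 2)
    (M : Fin 2 → Matrix (Fin 4) (Fin 4) ℂ) (hM : (M i₀).det ≠ 0)
    (hMB : ∑ a, ∑ b, ‖(M i₀)⁻¹ a b‖ ^ 2 ≤ B) :
    ∫⁻ z, ENNReal.ofReal (Real.exp (-κ * ∑ a, ∑ b, ‖combined (chan z) j M a b‖ ^ 2))
      ∂rayleighLaw ≤ ENNReal.ofReal (16 * (16 * B / κ) ^ 4) := by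
  let g (c : Fin 4 × Fin 4) : (Coord → ℂ) → ℝ≥0∞ :=
    {z | (16 * B)⁻¹ ≤ ‖(precoder (chan z) i₀ j * M i₀) c.1 c.2‖ ^ 2}.indicator
      fun z => ∏ a, ENNReal.ofReal (Real.exp (-κ * ‖combined (chan z) j M a c.2‖ ^ 2))
  have hgm (c) : Measurable (g c) := by
    refine Measurable.indicator ?_ (measurableSet_le measurable_const
      ((measurable_precoder_mul i₀ j (M i₀) c.1 c.2).norm.pow_const 2))
    exact Finset.measurable_prod _ fun a _ =>
      (((measurable_combined j M a c.2).norm.pow_const 2).const_mul _).exp.ennreal_ofReal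
  have hae : ∀ᵐ z ∂rayleighLaw, (chan z i₀ j.rev).det ≠ 0 :=
    ae_det_ne_zero 4 (fun c => Sum.inl (i₀, j.rev, c.1, c.2)) fun c d h => by
      simpa [Prod.ext_iff] using h
  calc _ ≤ ∫⁻ z, ∑ c, g c z ∂rayleighLaw := by
        refine lintegral_mono_ae (hae.mono fun z hz => ?_)
        obtain ⟨p, k, hpk⟩ := exists_le_normSq_mul (sum_normSq_precoder hz) hM hB hMB
        refine le_trans ?_ (Finset.single_le_sum (f := fun c => g c z)
          (fun _ _ => zero_le) (Finset.mem_univ (p, k)))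
        simp only [g]
        rw [Set.indicator_of_mem (by exact hpk),
          ← ENNReal.ofReal_prod_of_nonneg fun _ _ => (Real.exp_pos _).le, ← Real.exp_sum,
          ← Finset.mul_sum]
        refine ENNReal.ofReal_le_ofReal (Real.exp_le_exp.2 ?_)
        refine mul_le_mul_of_nonpos_left ?_ (by linarith)
        exact Finset.sum_le_sum fun a _ => Finset.single_le_sum
          (f := fun b => ‖combined (chan z) j M a b‖ ^ 2) (fun _ _ => by positivity)
          (Finset.mem_univ k)
    _ = ∑ c, ∫⁻ z, g c z ∂rayleighLaw := lintegral_finsetSum _ fun c _ => hgm c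
    _ ≤ ∑ _c : Fin 4 × Fin 4, ENNReal.ofReal (κ * (16 * B)⁻¹)⁻¹ ^ 4 :=
        Finset.sum_le_sum fun c _ =>
          lintegral_exp_combined_column_le hκ (by positivity) i₀ j M c.1 c.2
    _ = _ := by
        rw [Finset.sum_const, Finset.card_univ, nsmul_eq_mul, ← ENNReal.ofReal_pow (by positivity),
          ← ENNReal.ofReal_natCast, ← ENNReal.ofReal_mul (by positivity)]
        congr 2
        rw [mul_inv, inv_inv, mul_comm, div_eq_mul_inv]

/-! ### Pairwise error probability -/

lemma IsRayleigh.exists_coord {Ω : Type*} [MeasurableSpace Ω] {μ : Measure Ω}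
    [IsProbabilityMeasure μ] {H : Ω → Channels} {N : Ω → Matrix (Fin 4) (Fin 6) ℂ}
    (h : IsRayleigh μ H N) :
    ∃ Z : Ω → Coord → ℂ, AEMeasurable Z μ ∧ μ.map Z = rayleighLaw ∧
      (∀ ω, chan (Z ω) = H ω) ∧ ∀ ω, noise (Z ω) = N ω := by
  let X : Coord → Ω → ℂ :=
    Sum.elim (fun (a : Fin 2 × Fin 2 × Fin 4 × Fin 4) ω => H ω a.1 a.2.1 a.2.2.1 a.2.2.2)
      (fun (a : Fin 4 × Fin 6) ω => N ω a.1 a.2)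
  have hX (c : Coord) : HasLaw (X c) (complexGaussian 1) μ := by
    rcases c with c | c
    · exact h.channel_law _ _ _ _
    · exact h.noise_law _ _
  refine ⟨fun ω c => X c ω, aemeasurable_pi_lambda _ fun c => (hX c).aemeasurable, ?_,
    fun ω => rfl, fun ω => rfl⟩
  rw [(iIndepFun_iff_map_fun_eq_pi_map fun c => (hX c).aemeasurable).1 h.indep]
  exact congrArg Measure.pi (funext fun c => (hX c).map_eq)

lemma measure_pairwise_le {Ω : Type*} [MeasurableSpace Ω] {μ : Measure Ω}
    [IsProbabilityMeasure μ] {H : Ω → Channels} {N : Ω → Matrix (Fin 4) (Fin 6) ℂ}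
    (h : IsRayleigh μ H N) {θ P B : ℝ} (hP : 0 < P) (hB : 0 < B) (j : Fin 2)
    (x : Fin 2 → Fin 2 → Fin 8 → ℂ) (d : Fin 2 → Fin 8 → ℂ) {i₀ : Fin 2}
    (hM : (srCode θ (x i₀ j) - srCode θ (d i₀)).det ≠ 0)
    (hMB : ∑ a, ∑ b, ‖(srCode θ (x i₀ j) - srCode θ (d i₀))⁻¹ a b‖ ^ 2 ≤ B) :
    μ {ω | likelihood θ P (H ω) j (process θ j (received θ P (H ω) x j (N ω)))
          (fun i => x i j) ≤
        likelihood θ P (H ω) j (process θ j (received θ P (H ω) x j (N ω))) d} ≤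
      ENNReal.ofReal (16 * (512 * B / 3) ^ 4 * P ^ (-4 : ℤ)) := by
  obtain ⟨Z, hZ, hlaw, hch, hno⟩ := h.exists_coord
  let M : Fin 2 → Matrix (Fin 4) (Fin 4) ℂ := fun i => srCode θ (x i j) - srCode θ (d i)
  let D (z : Coord → ℂ) : Matrix (Fin 4) (Fin 4) ℂ :=
    (Real.sqrt (3 * P / 4) : ℂ) • combined (chan z) j M
  have hD (a b) : Measurable fun z => D z a b := (measurable_combined j M a b).const_mul _
  have hinv (z z' : Coord → ℂ) (hz : ∀ c, z' (Sum.inl c) = z (Sum.inl c)) : D z' = D z := by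
    have : chan z' = chan z := by
      funext i l; ext a b; exact hz _
    simp only [D, this]
  have hm := (measurable_chernoffExponent hD θ j).exp.ennreal_ofReal
  calc _ ≤ μ {ω | 1 ≤ ENNReal.ofReal
            (Real.exp (chernoffExponent θ j (D (Z ω)) (noise (Z ω))))} := by
        refine measure_mono fun ω hω => ?_
        rw [Set.mem_ofPred_eq, pairwise_event_iff θ P (H ω) x j (N ω) d
          (signal_sub θ P (H ω) j _ d)] at hω
        rw [Set.mem_ofPred_eq, ENNReal.one_le_ofReal, Real.one_le_exp_iff, hno]
        simp only [D, chernoffExponent, hch, M]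
        linarith
    _ ≤ ∫⁻ ω, ENNReal.ofReal (Real.exp (chernoffExponent θ j (D (Z ω)) (noise (Z ω)))) ∂μ := by
        simpa using meas_ge_le_lintegral_div (hm.comp_aemeasurable hZ) one_ne_zero
          ENNReal.one_ne_top
    _ = ∫⁻ z, ENNReal.ofReal (Real.exp (chernoffExponent θ j (D z) (noise z)))
          ∂rayleighLaw := by
        rw [← hlaw, lintegral_map' hm.aemeasurable hZ]
    _ ≤ ∫⁻ z, ENNReal.ofReal (Real.exp (-(weightedNormSq j (D z) / 4))) ∂rayleighLaw :=
        lintegral_exp_chernoffExponent_le hD hinv θ j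
    _ ≤ ∫⁻ z, ENNReal.ofReal (Real.exp
          (-(3 * P / 32) * ∑ a, ∑ b, ‖combined (chan z) j M a b‖ ^ 2)) ∂rayleighLaw := by
        refine lintegral_mono fun z => ENNReal.ofReal_le_ofReal (Real.exp_le_exp.2 ?_)
        -- The power factor `3P/4` is divided by the largest noise variance, 2.
        have : (3 * P / 8) * ∑ a, ∑ b, ‖combined (chan z) j M a b‖ ^ 2 ≤
            weightedNormSq j (D z) := by
          simp only [weightedNormSq, Finset.mul_sum]
          refine Finset.sum_le_sum fun a _ => Finset.sum_le_sum fun b _ => ?_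
          rw [le_div_iff₀ (noiseVar_pos j b)]
          simp only [D, Matrix.smul_apply, smul_eq_mul, norm_mul, mul_pow, Complex.norm_real,
            Real.norm_eq_abs, sq_abs]
          rw [Real.sq_sqrt (by positivity)]
          have h0 : 0 ≤ 3 * P / 8 * ‖combined (chan z) j M a b‖ ^ 2 := by positivity
          nlinarith [mul_le_mul_of_nonneg_left (noiseVar_le j b) h0]
        linarith
    _ ≤ ENNReal.ofReal (16 * (16 * B / (3 * P / 32)) ^ 4) :=
        lintegral_exp_combined_le (by positivity) hB i₀ j M hM hMB
    _ = _ := by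
        congr 1
        rw [zpow_neg]
        norm_cast
        field_simp
        norm_num

/-! ### Diversity gain -/

lemma le_diversityGain {pe : ℝ → ℝ≥0∞} {c : ℝ} (hc : 0 < c)
    (h : ∀ P : ℝ, 0 < P → pe P ≤ ENNReal.ofReal (c * P ^ (-4 : ℤ))) :
    4 ≤ diversityGain pe := by
  have ht : Tendsto (fun P : ℝ => ((4 - Real.log c / Real.log P : ℝ) : EReal)) atTop
      (nhds ((4 : ℝ) : EReal)) := by
    refine (continuous_coe_real_ereal.tendsto _).comp ?_
    simpa using tendsto_const_nhds.sub (Real.tendsto_log_atTop.const_div_atTop (Real.log c))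
  have h4 : (4 : EReal) = ((4 : ℝ) : EReal) := by norm_cast
  rw [h4, ← ht.liminf_eq]
  refine liminf_le_liminf ?_
  filter_upwards [eventually_gt_atTop 1] with P hP
  have hP0 : 0 < P := by linarith
  have hl : 0 < Real.log P := Real.log_pos hP
  have hlog : ENNReal.log (pe P) ≤ ((Real.log c - 4 * Real.log P : ℝ) : EReal) := by
    refine (ENNReal.log_monotone (h P hP0)).trans (le_of_eq ?_)
    rw [ENNReal.log_ofReal_of_pos (by positivity), Real.log_mul hc.ne' (by positivity),
      Real.log_zpow]
    congr 1
    push_cast; ring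
  have e : 4 - Real.log c / Real.log P =
      -(Real.log c - 4 * Real.log P) / Real.log P := by field_simp; ring
  rw [e, EReal.coe_div, EReal.coe_neg]
  exact EReal.div_le_div_right_of_nonneg (by exact_mod_cast hl.le) (EReal.neg_le_neg_iff.2 hlog)

/-- A wrong decision is at least as likely as the truth, however ties are broken, so the union bound
over competitors applies. No measurability of the decoder is needed. -/
lemma errorProb_le {S : Fin 2 → Fin 2 → Fin 8 → Finset ℂ} {Ω : Type*} [MeasurableSpace Ω]
    {μ : Measure Ω} {H : Ω → Channels} {N : Ω → Matrix (Fin 4) (Fin 6) ℂ} {θ P : ℝ} {j : Fin 2}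
    {dec : Channels → Matrix (Fin 4) (Fin 4) ℂ → Fin 2 → Fin 8 → ℂ}
    (hdec : IsMLDecoder S θ P j dec) {q : ℝ≥0∞}
    (hq : ∀ x ∈ allSymbols S, ∀ d ∈ desired S j, d ≠ (fun i => x i j) →
      μ {ω | likelihood θ P (H ω) j (process θ j (received θ P (H ω) x j (N ω)))
          (fun i => x i j) ≤
        likelihood θ P (H ω) j (process θ j (received θ P (H ω) x j (N ω))) d} ≤ q) :
    errorProb S μ H N θ P j dec ≤ (desired S j).card * q := by
  have hx : ∀ x ∈ allSymbols S,
      μ {ω | dec (H ω) (process θ j (received θ P (H ω) x j (N ω))) ≠ fun i => x i j} ≤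
        (desired S j).card * q := by
    intro x hx
    have hxd : (fun i => x i j) ∈ desired S j := by
      simp only [allSymbols, desired, Fintype.mem_piFinset] at hx ⊢
      exact fun i => hx i j
    calc _ ≤ μ (⋃ d ∈ (desired S j).erase (fun i => x i j),
            {ω | likelihood θ P (H ω) j (process θ j (received θ P (H ω) x j (N ω)))
              (fun i => x i j) ≤
            likelihood θ P (H ω) j (process θ j (received θ P (H ω) x j (N ω))) d}) := by
          refine measure_mono fun ω hω => ?_
          obtain ⟨h1, h2⟩ := hdec (H ω) (process θ j (received θ P (H ω) x j (N ω)))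
          exact Set.mem_biUnion (Finset.mem_coe.2 (Finset.mem_erase.2 ⟨hω, h1⟩)) (h2 _ hxd)
      _ ≤ ∑ d ∈ (desired S j).erase (fun i => x i j), q :=
          (measure_biUnion_finset_le _ _).trans <| Finset.sum_le_sum fun d hd =>
            hq x hx d (Finset.mem_of_mem_erase hd) (Finset.ne_of_mem_erase hd)
      _ ≤ _ := by
          rw [Finset.sum_const, nsmul_eq_mul]
          gcongr
          exact Finset.erase_subset _ _
  calc _ ≤ ((allSymbols S).card : ℝ≥0∞)⁻¹ * ∑ _x ∈ allSymbols S, (desired S j).card * q := by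
        rw [errorProb]
        gcongr with x h
        exact hx x h
    _ ≤ _ := by
        rw [Finset.sum_const, nsmul_eq_mul, ← mul_assoc]
        exact mul_le_of_le_one_left zero_le (ENNReal.inv_mul_le_one _)

/-- A common bound on the inverse difference matrices. -/
lemma exists_bound_inverse (S : Fin 2 → Fin 2 → Fin 8 → Finset ℂ) (θ : ℝ) :
    ∃ B : ℝ, 0 < B ∧ ∀ i j, ∀ s ∈ symbolVectors (S i j), ∀ t ∈ symbolVectors (S i j),
      ∑ a, ∑ b, ‖(srCode θ s - srCode θ t)⁻¹ a b‖ ^ 2 ≤ B := by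
  let f (q : (Fin 8 → ℂ) × (Fin 8 → ℂ)) : ℝ :=
    ∑ a, ∑ b, ‖(srCode θ q.1 - srCode θ q.2)⁻¹ a b‖ ^ 2
  let U : Finset ((Fin 8 → ℂ) × (Fin 8 → ℂ)) := Finset.univ.biUnion fun c : Fin 2 × Fin 2 =>
    symbolVectors (S c.1 c.2) ×ˢ symbolVectors (S c.1 c.2)
  have hf (q) : 0 ≤ f q := by positivity
  refine ⟨1 + ∑ q ∈ U, f q, by have := Finset.sum_nonneg (s := U) fun q _ => hf q; linarith,
    fun i j s hs t ht => ?_⟩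
  have : f (s, t) ≤ ∑ q ∈ U, f q := Finset.single_le_sum (fun q _ => hf q) <|
    Finset.mem_biUnion.2 ⟨(i, j), Finset.mem_univ _, Finset.mk_mem_product hs ht⟩
  exact this.trans (by linarith)

lemma det_ne_zero_of_rank_eq_four {A : Matrix (Fin 4) (Fin 4) ℂ} (h : A.rank = 4) :
    A.det ≠ 0 := by
  have hr : LinearMap.range A.mulVecLin = ⊤ :=
    Submodule.eq_top_of_finrank_eq (by rw [← Matrix.rank, h]; simp)
  have hs : Function.Surjective A.mulVec := LinearMap.range_eq_top.1 hr
  exact ((Matrix.isUnit_iff_isUnit_det A).1 (Matrix.mulVec_surjective_iff_isUnit.1 hs)).ne_zero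

end XNetwork

theorem theorem4 (S : Fin 2 → Fin 2 → Fin 8 → Finset ℂ) (θ : ℝ)
    (hCPD : ∀ i j k, constellationCPD (S i j k) ≠ 0)
    (hrank : ∀ i j, ∀ s ∈ symbolVectors (S i j), ∀ t ∈ symbolVectors (S i j), s ≠ t →
      (srCode θ s - srCode θ t).rank = 4) :
    ∃ c : ℝ, 0 < c ∧
      ∀ (Ω : Type*) [MeasurableSpace Ω] (μ : Measure Ω) [IsProbabilityMeasure μ]
        (H : Ω → Channels) (N : Ω → Matrix (Fin 4) (Fin 6) ℂ), IsRayleigh μ H N →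
      ∀ j : Fin 2,
        (∀ P : ℝ, 0 < P → ∀ x ∈ allSymbols S, ∀ d ∈ desired S j, d ≠ (fun i => x i j) →
          pairwiseError μ H N θ P j x d ≤ c * P ^ (-4 : ℤ)) ∧
        (∀ dec : ℝ → Channels → Matrix (Fin 4) (Fin 4) ℂ → Fin 2 → Fin 8 → ℂ,
          (∀ P : ℝ, 0 < P → IsMLDecoder S θ P j (dec P)) →
          4 ≤ diversityGain fun P => errorProb S μ H N θ P j (dec P)) := by
  obtain ⟨B, hB, hBS⟩ := exists_bound_inverse S θ
  set c₀ : ℝ := 16 * (512 * B / 3) ^ 4 with hc₀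
  have hc₀pos : 0 < c₀ := by positivity
  refine ⟨c₀, hc₀pos, fun Ω _ μ _ H N hR j => ?_⟩
  have key : ∀ P : ℝ, 0 < P → ∀ x ∈ allSymbols S, ∀ d ∈ desired S j, d ≠ (fun i => x i j) →
      μ {ω | likelihood θ P (H ω) j (process θ j (received θ P (H ω) x j (N ω)))
          (fun i => x i j) ≤
        likelihood θ P (H ω) j (process θ j (received θ P (H ω) x j (N ω))) d} ≤
      ENNReal.ofReal (c₀ * P ^ (-4 : ℤ)) := by
    intro P hP x hx d hd hne
    -- One transmitter with differing symbols suffices; the code difference of the other may be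
    -- zero.
    obtain ⟨i₀, hi₀⟩ := Function.ne_iff.1 hne
    have hxs : x i₀ j ∈ symbolVectors (S i₀ j) := by
      simp only [allSymbols, Fintype.mem_piFinset] at hx
      exact hx i₀ j
    have hds : d i₀ ∈ symbolVectors (S i₀ j) := by
      simp only [desired, Fintype.mem_piFinset] at hd
      exact hd i₀
    exact measure_pairwise_le hR hP hB j x d
      (det_ne_zero_of_rank_eq_four (hrank i₀ j _ hxs _ hds (Ne.symm hi₀)))
      (hBS i₀ j _ hxs _ hds)
  refine ⟨fun P hP x hx d hd hne => ?_, fun dec hdec => ?_⟩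
  · exact ENNReal.toReal_le_of_le_ofReal (by positivity) (key P hP x hx d hd hne)
  -- The `+ 1` keeps the constant positive even if there are no symbol vectors.
  · refine le_diversityGain (c := ((desired S j).card + 1) * c₀) (by positivity) fun P hP => ?_
    refine (errorProb_le (hdec P hP) (key P hP)).trans ?_
    rw [← ENNReal.ofReal_natCast, ← ENNReal.ofReal_mul (by positivity), mul_assoc (_ + 1)]
    refine ENNReal.ofReal_le_ofReal ?_
    gcongr
    linarith
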